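/- A unary semigroup is a semigroup with an additional unary operation (subject to no law). A graph $\mathsf G=\langle V;\sim\rangle$ is a (possibly empty) set $V$ with an arbitrary binary relation $\sim$ on it (so graphs are directed and loops are allowed). Its adjacency semigroup $\mathrm A(\mathsf G)$ is the unary semigroup on $(V\times V)\cup\{0\}$ with $(x,y)(z,t)=(x,t)$ if $y\sim z$, $(x,y)(z,t)=0$ if $y\not\sim z$, $a0=0a=0$, $(x,y)'=(y,x)$, $0'=0$. Let $\mathscr A$, $\mathscr A_{\mathrm{symm}}$ and $\mathscr A_{\mathrm{ref}}$ be the varieties $\mathbb{HSP}(\cdot)$ of unary semigroups generated by the adjacency semigroups of all graphs, of all symmetric graphs, and of all reflexive graphs, respectively. Let $\mathsf G_1$ be the graph on $\{0,1,2,3\}$ with loops at $1,2,3$, with edges in both directions between $0$ and $1$, between $1$ and $3$, and between $2$ and $3$, with the one-way edge $1\sim 2$, and with no other edges. Let $\mathsf S_1$ be the graph on $\{0,1,2,3\}$ with loops at $1,2,3$, with edges in both directions between $0$ and $1$, between $1$ and $2$, and between $2$ and $3$, and with no other edges. Let $\mathsf R_1$ be the graph on $\{0,1,2\}$ with loops at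 all three vertices, with edges in both directions between $0$ and $2$ and between $1$ and $2$, with the one-way edge $0\sim 1$, and with no other edges. Then $\mathscr A=\mathbb{HSP}(\mathrm A(\mathsf G_1))$, $\mathscr A_{\mathrm{symm}}=\mathbb{HSP}(\mathrm A(\mathsf S_1))$ and $\mathscr A_{\mathrm{ref}}=\mathbb{HSP}(\mathrm A(\mathsf R_1))$; that is, the three varieties are generated by the finite adjacency semigroups $\mathrm A(\mathsf G_1)$, $\mathrm A(\mathsf S_1)$ and $\mathrm A(\mathsf R_1)$, which have $17$, $17$ and $10$ elements, respectively. -/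

import Mathlib

universe u v

namespace AdjSemigroup

/-! ### Unary semigroups and the class operators -/

/-- A unary semigroup: a semigroup with an additional unary operation `rev` (`a ↦ a'`), which is
not required to satisfy any law. -/
class UnarySemigroup (S : Type u) extends Semigroup S where
  rev : S → S

/-- Homomorphisms of unary semigroups. -/
structure IsUnaryHom {S : Type u} {T : Type v} [UnarySemigroup S] [UnarySemigroup T]
    (f : S → T) : Prop where
  map_mul : ∀ x y, f (x * y) = f x * f y
  map_rev : ∀ x, f (UnarySemigroup.rev x) = UnarySemigroup.rev (f x)

/-- Bundled unary semigroups. As usual for algebras, the underlying set is nonempty. -/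
structure USgrp where
  carrier : Type u
  [inst : UnarySemigroup carrier]
  [nonempty : Nonempty carrier]

attribute [instance] USgrp.inst USgrp.nonempty

/-- The direct product of unary semigroups, with coordinatewise operations. -/
instance piUnarySemigroup {ι : Type v} (S : ι → Type u) [∀ i, UnarySemigroup (S i)] :
    UnarySemigroup (∀ i, S i) where
  rev a := fun i => UnarySemigroup.rev (a i)

/-- The bundled direct product of a (possibly empty) family of unary semigroups. -/
def USgrp.pi {ι : Type v} (S : ι → USgrp.{u}) : USgrp.{max u v} where
  carrier := ∀ i, (S i).carrier

/-- The class of all homomorphic images of members of `K`. -/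
def opH (K : Set USgrp.{u}) : Set USgrp.{u} :=
  {T | ∃ S ∈ K, ∃ f : S.carrier → T.carrier, IsUnaryHom f ∧ Function.Surjective f}

/-- The class of all (isomorphic copies of) subalgebras of members of `K`. -/
def opS (K : Set USgrp.{u}) : Set USgrp.{u} :=
  {T | ∃ S ∈ K, ∃ f : T.carrier → S.carrier, IsUnaryHom f ∧ Function.Injective f}

/-- The class of all (isomorphic copies of) direct products of set-indexed families of members
of `K`, the empty product (the one-element algebra) included. -/
def opP (K : Set USgrp.{u}) : Set USgrp.{max u v} :=
  {T | ∃ (ι : Type v) (S : ι → USgrp.{u}), (∀ i, S i ∈ K) ∧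
    ∃ f : T.carrier → (USgrp.pi S).carrier, IsUnaryHom f ∧ Function.Bijective f}

/-- The variety of unary semigroups generated by the class `K`. The second universe is that of
the index sets of the direct products, so that finite generators may stay in `Type 0`. -/
def HSP (K : Set USgrp.{u}) : Set USgrp.{max u v} :=
  opH (opS (opP.{u, v} K))

/-! ### Adjacency semigroups

A graph is a set with an arbitrary binary relation, loops allowed; this is Mathlib's `Digraph`. -/

/-- The underlying set `(V × V) ∪ {0}` of the adjacency semigroup of `G`. -/
inductive Carrier {V : Type u} (G : Digraph V) : Type u
  | zero : Carrier G
  | pair (x y : V) : Carrier G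

namespace Carrier

variable {V : Type u} {G : Digraph V}

open Classical in
/-- `(x, y)(z, t)` is `(x, t)` if `y ∼ z` and `0` otherwise; all products with `0` are `0`. -/
noncomputable def mul : Carrier G → Carrier G → Carrier G
  | pair x y, pair z t => if G.Adj y z then pair x t else zero
  | _, _ => zero

/-- Reversion: `(x, y)' = (y, x)` and `0' = 0`. -/
def rev : Carrier G → Carrier G
  | pair x y => pair y x
  | zero => zero

theorem mul_assoc' (a b c : Carrier G) : mul (mul a b) c = mul a (mul b c) := by
  cases a <;> cases b <;> cases c <;> simp only [mul]
  all_goals (try split_ifs) <;> simp_all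

noncomputable instance : UnarySemigroup (Carrier G) where
  mul := mul
  mul_assoc := mul_assoc'
  rev := rev

instance : Nonempty (Carrier G) := ⟨zero⟩

end Carrier

/-- The adjacency semigroup `A(G)` of a graph `G`, as a unary semigroup. -/
noncomputable def A {V : Type u} (G : Digraph V) : USgrp.{u} where
  carrier := Carrier G

/-! ### The varieties -/

/-- The variety generated by the adjacency semigroups of all graphs. -/
def varA : Set USgrp.{u} :=
  HSP.{u, u} {S | ∃ (V : Type u) (G : Digraph V), S = A G}

/-- The variety generated by the adjacency semigroups of all symmetric graphs. -/
def varAsymm : Set USgrp.{u} :=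
  HSP.{u, u} {S | ∃ (V : Type u) (G : Digraph V),
    (∀ x y, G.Adj x y → G.Adj y x) ∧ S = A G}

/-- The variety generated by the adjacency semigroups of all reflexive graphs. -/
def varAref : Set USgrp.{u} :=
  HSP.{u, u} {S | ∃ (V : Type u) (G : Digraph V), (∀ x, G.Adj x x) ∧ S = A G}

/-! ### The three finite graphs -/

/-- Vertices `0, 1, 2, 3`; loops at `1, 2, 3`; undirected edges `01`, `13`, `23`;
a one-way edge from `1` to `2`. -/
def G₁ : Digraph (Fin 4) where
  Adj x y := (x, y) ∈ ({(1, 1), (2, 2), (3, 3), (0, 1), (1, 0), (1, 3), (3, 1), (2, 3), (3, 2),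
    (1, 2)} : Finset (Fin 4 × Fin 4))

/-- Vertices `0, 1, 2, 3`; loops at `1, 2, 3`; undirected edges `01`, `12`, `23`. -/
def S₁ : Digraph (Fin 4) where
  Adj x y := (x, y) ∈ ({(1, 1), (2, 2), (3, 3), (0, 1), (1, 0), (1, 2), (2, 1), (2, 3), (3, 2)} :
    Finset (Fin 4 × Fin 4))

/-- Vertices `0, 1, 2`; loops at all vertices; undirected edges `02`, `12`; a one-way edge from
`0` to `1`. -/
def R₁ : Digraph (Fin 3) where
  Adj x y := (x, y) ∈ ({(0, 0), (1, 1), (2, 2), (0, 2), (2, 0), (1, 2), (2, 1), (0, 1)} :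
    Finset (Fin 3 × Fin 3))

end AdjSemigroup

namespace AdjSemigroup

open UnarySemigroup

universe w x

/-! Sending a vertex `x` to the tuple of its images under all homomorphisms `G → H` turns the pairs
of `G` into tuples in a power of `A H`. If these homomorphisms separate vertices and detect
non-edges, collapsing all tuples with a zero coordinate recovers `A G` (`dividesProduct_A`). So it
suffices to find, in each finite graph, targets for such homomorphisms. Each has a looped vertex `c`
joined both ways to the two vertices `a`, `b` modelling a non-edge, so all other vertices can go to
`c` (`colour_hom`). Conversely, each finite graph belongs to the class that it generates, up to a
change of universe. -/

/-- A relation between two unary semigroups which exhibits the second as a homomorphic image of a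
subalgebra of the first. -/
structure IsDivision {X : Type v} {Y : Type w} [UnarySemigroup X] [UnarySemigroup Y]
    (R : X → Y → Prop) : Prop where
  mul : ∀ {a a' b b'}, R a b → R a' b' → R (a * a') (b * b')
  rev : ∀ {a b}, R a b → R (rev a) (rev b)
  functional : ∀ {a b b'}, R a b → R a b' → b = b'
  surj : ∀ b, ∃ a, R a b

/-- The domain of a division, as a unary semigroup. -/
abbrev IsDivision.domain {X : Type v} {Y : Type w} [UnarySemigroup X] [UnarySemigroup Y]
    {R : X → Y → Prop} (hR : IsDivision R) : UnarySemigroup {a // ∃ b, R a b} where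
  mul a a' := ⟨a.1 * a'.1, a.2.elim fun _ h => a'.2.elim fun _ h' => ⟨_, hR.mul h h'⟩⟩
  mul_assoc a b c := Subtype.ext (mul_assoc a.1 b.1 c.1)
  rev a := ⟨UnarySemigroup.rev a.1, a.2.elim fun _ h => ⟨_, hR.rev h⟩⟩

/-- The unary semigroup `T` divides a direct product, indexed by a type in universe `v`, of members
of `K`. -/
def DividesProduct (K : Set USgrp.{u}) (T : Type w) [UnarySemigroup T] : Prop :=
  ∃ (ι : Type v) (S : ι → USgrp.{u}), (∀ i, S i ∈ K) ∧
    ∃ R : (∀ i, (S i).carrier) → T → Prop, IsDivision R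

theorem mem_HSP_iff {K : Set USgrp.{u}} {T : USgrp.{max u v}} :
    T ∈ HSP.{u, v} K ↔ DividesProduct.{u, v} K T.carrier := by
  constructor
  · rintro ⟨W, ⟨P, ⟨ι, S, hS, e, he, he_inj, -⟩, g, hg, hgi⟩, f, hf, hfs⟩
    refine ⟨ι, S, hS, fun a t => ∃ w, e (g w) = a ∧ f w = t, ?_, ?_, ?_, ?_⟩
    · rintro _ _ _ _ ⟨w, rfl, rfl⟩ ⟨w', rfl, rfl⟩
      exact ⟨w * w', by rw [hg.map_mul, he.map_mul]; rfl, hf.map_mul _ _⟩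
    · rintro _ _ ⟨w, rfl, rfl⟩
      exact ⟨rev w, by rw [hg.map_rev, he.map_rev]; rfl, hf.map_rev _⟩
    · rintro _ _ _ ⟨w, rfl, rfl⟩ ⟨w', h, rfl⟩
      rw [hgi (he_inj h)]
    · intro t
      obtain ⟨w, rfl⟩ := hfs t
      exact ⟨_, w, rfl, rfl⟩
  · rintro ⟨ι, S, hS, R, hR⟩
    let := hR.domain
    have : Nonempty {a // ∃ b, R a b} :=
      let ⟨t⟩ := T.nonempty
      let ⟨a, ha⟩ := hR.surj t
      ⟨⟨a, t, ha⟩⟩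
    refine ⟨⟨{a // ∃ b, R a b}⟩, ⟨USgrp.pi S, ⟨ι, S, hS, id, ⟨fun _ _ => rfl, fun _ => rfl⟩,
      Function.bijective_id⟩, Subtype.val, ⟨fun _ _ => rfl, fun _ => rfl⟩,
      Subtype.val_injective⟩, fun a => a.2.choose, ⟨fun a b => ?_, fun a => ?_⟩, fun t => ?_⟩
    · exact hR.functional (a * b).2.choose_spec (hR.mul a.2.choose_spec b.2.choose_spec)
    · exact hR.functional (rev a).2.choose_spec (hR.rev a.2.choose_spec)
    · obtain ⟨a, ha⟩ := hR.surj t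
      exact ⟨⟨a, t, ha⟩, hR.functional (Exists.choose_spec (⟨t, ha⟩ : ∃ b, R a b)) ha⟩

/-- A product of products is a product over the sigma type, and divisions compose coordinatewise. -/
theorem DividesProduct.trans {K : Set USgrp.{u}} {K' : Set USgrp.{x}} {T : Type w}
    [UnarySemigroup T] (hT : DividesProduct.{u, v} K T)
    (hK : ∀ S ∈ K, DividesProduct.{x, v} K' S.carrier) : DividesProduct.{x, v} K' T := by
  obtain ⟨ι, S, hS, R, hR⟩ := hT
  choose κ S' hS' Q hQ using fun i => hK (S i) (hS i)
  refine ⟨Σ i, κ i, fun p => S' p.1 p.2, fun p => hS' _ _,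
    fun a t => ∃ b, (∀ i, Q i (fun j => a ⟨i, j⟩) (b i)) ∧ R b t, ?_, ?_, ?_, ?_⟩
  · rintro _ _ _ _ ⟨b, hb, h⟩ ⟨b', hb', h'⟩
    exact ⟨b * b', fun i => (hQ i).mul (hb i) (hb' i), hR.mul h h'⟩
  · rintro _ _ ⟨b, hb, h⟩
    exact ⟨rev b, fun i => (hQ i).rev (hb i), hR.rev h⟩
  · rintro _ _ _ ⟨b, hb, h⟩ ⟨b', hb', h'⟩
    obtain rfl : b = b' := funext fun i => (hQ i).functional (hb i) (hb' i)
    exact hR.functional h h'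
  · intro t
    obtain ⟨b, hb⟩ := hR.surj t
    choose a ha using fun i => (hQ i).surj (b i)
    exact ⟨fun p => a p.1 p.2, b, ha, hb⟩

namespace Carrier

variable {V : Type u} {G : Digraph V}

theorem zero_mul (a : Carrier G) : zero * a = zero := rfl

theorem mul_zero (a : Carrier G) : a * zero = zero := by cases a <;> rfl

theorem pair_mul_of_adj {x y z t : V} (h : G.Adj y z) :
    (pair x y * pair z t : Carrier G) = pair x t := if_pos h

theorem pair_mul_of_not_adj {x y z t : V} (h : ¬ G.Adj y z) :
    (pair x y * pair z t : Carrier G) = zero := if_neg h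

end Carrier

open Carrier in
/-- If the homomorphisms from `G` to `H` separate the vertices and the non-edges of `G`, then
`A G` divides a power of `A H`: it is the Rees quotient of a subalgebra by the ideal of tuples
with a zero coordinate. -/
theorem dividesProduct_A {V : Type w} {W : Type u} (G : Digraph V) (H : Digraph W)
    (hne : ∃ φ : V → W, ∀ x y, G.Adj x y → H.Adj (φ x) (φ y))
    (hadj : ∀ u v, ¬ G.Adj u v →
      ∃ φ : V → W, (∀ x y, G.Adj x y → H.Adj (φ x) (φ y)) ∧ ¬ H.Adj (φ u) (φ v))
    (hsep : ∀ u v, u ≠ v →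
      ∃ φ : V → W, (∀ x y, G.Adj x y → H.Adj (φ x) (φ y)) ∧ φ u ≠ φ v) :
    DividesProduct.{u, max u w} {A H} (A G).carrier := by
  refine ⟨{φ : V → W // ∀ x y, G.Adj x y → H.Adj (φ x) (φ y)}, fun _ => A H, fun _ => rfl,
    fun (a : _ → Carrier H) (b : Carrier G) => (b = zero ∧ ∃ φ, a φ = zero) ∨
      ∃ x y, b = pair x y ∧ ∀ φ, a φ = pair (φ.1 x) (φ.1 y), ?_, ?_, ?_, ?_⟩
  · rintro a a' _ _ (⟨rfl, φ, h⟩ | ⟨x, y, rfl, h⟩) h'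
    · exact Or.inl ⟨rfl, φ, (congrArg (· * a' φ) h).trans (zero_mul _)⟩
    · rcases h' with ⟨rfl, φ, h'⟩ | ⟨z, t, rfl, h'⟩
      · exact Or.inl ⟨rfl, φ, (congrArg (a φ * ·) h').trans (mul_zero _)⟩
      · have key : ∀ φ, (a * a' : _ → Carrier H) φ =
            (pair (φ.1 x) (φ.1 y) * pair (φ.1 z) (φ.1 t) : Carrier H) := fun φ =>
          congrArg₂ (· * ·) (h φ) (h' φ)
        by_cases hyz : G.Adj y z
        · exact Or.inr ⟨x, t, pair_mul_of_adj hyz, fun φ =>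
            (key φ).trans (pair_mul_of_adj (φ.2 _ _ hyz))⟩
        -- One homomorphism preserving the non-edge makes one coordinate zero, which suffices to
        -- enter the ideal.
        · obtain ⟨φ, hφ, hn⟩ := hadj y z hyz
          exact Or.inl ⟨pair_mul_of_not_adj hyz, ⟨φ, hφ⟩,
            (key ⟨φ, hφ⟩).trans (pair_mul_of_not_adj hn)⟩
  · rintro a _ (⟨rfl, φ, h⟩ | ⟨x, y, rfl, h⟩)
    · exact Or.inl ⟨rfl, φ, congrArg Carrier.rev h⟩
    · exact Or.inr ⟨y, x, rfl, fun φ => congrArg Carrier.rev (h φ)⟩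
  · rintro a _ _ (⟨rfl, φ, h⟩ | ⟨x, y, rfl, h⟩) (⟨rfl, ψ, h'⟩ | ⟨z, t, rfl, h'⟩)
    · rfl
    · exact nomatch h.symm.trans (h' φ)
    · exact nomatch h'.symm.trans (h ψ)
    · have key φ := Carrier.pair.inj ((h φ).symm.trans (h' φ))
      have hxz : x = z := by
        by_contra hne
        obtain ⟨φ, hφ, hn⟩ := hsep _ _ hne
        exact hn (key ⟨φ, hφ⟩).1
      have hyt : y = t := by
        by_contra hne
        obtain ⟨φ, hφ, hn⟩ := hsep _ _ hne
        exact hn (key ⟨φ, hφ⟩).2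
      rw [hxz, hyt]
  · rintro (_ | ⟨x, y⟩)
    -- Without any homomorphism the power would be trivial and zero would have no preimage; `hne`
    -- rules this out.
    · exact ⟨fun _ => zero, Or.inl ⟨rfl, hne.elim fun φ h => ⟨⟨φ, h⟩, rfl⟩⟩⟩
    · exact ⟨fun φ => pair (φ.1 x) (φ.1 y), Or.inr ⟨x, y, rfl, fun _ => rfl⟩⟩

/-- A copy of the graph `H` in a higher universe. -/
def liftGraph {W : Type v} (H : Digraph W) : Digraph (ULift.{u} W) where
  Adj x y := H.Adj x.down y.down

theorem HSP_eq_of_dividesProduct {W : Type} (H : Digraph W)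
    (P : ∀ {V : Type u}, Digraph V → Prop) (hP : P (liftGraph.{u} H))
    (h : ∀ {V : Type u} (G : Digraph V), P G → DividesProduct.{0, u} {A H} (A G).carrier) :
    HSP.{u, u} {S | ∃ (V : Type u) (G : Digraph V), P G ∧ S = A G} = HSP.{0, u} {A H} := by
  ext T
  refine (mem_HSP_iff.{u, u}).trans (Iff.trans ⟨fun hT => hT.trans ?_, fun hT => hT.trans ?_⟩
    (mem_HSP_iff.{0, u}).symm)
  · rintro _ ⟨V, G, hG, rfl⟩
    exact h G hG
  · rintro _ rfl
    have hom : ∀ x y, H.Adj x y → (liftGraph.{u} H).Adj ⟨x⟩ ⟨y⟩ := fun _ _ h => h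
    obtain ⟨ι, S, hS, R, hR⟩ := dividesProduct_A H (liftGraph.{u} H) ⟨ULift.up, hom⟩
      (fun u v huv => ⟨ULift.up, hom, huv⟩)
      (fun u v huv => ⟨ULift.up, hom, fun e => huv (ULift.up_injective e)⟩)
    exact ⟨ι, S, fun i => ⟨_, _, hP, hS i⟩, R, hR⟩

theorem card_A {V : Type} [Fintype V] (G : Digraph V) :
    Nat.card (A G).carrier = Fintype.card V * Fintype.card V + 1 := by
  have e : Carrier G ≃ Option (V × V) :=
    { toFun := fun a => match a with
        | .zero => none
        | .pair x y => some (x, y)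
      invFun := fun a => match a with
        | none => .zero
        | some p => .pair p.1 p.2
      left_inv := by rintro (_ | _) <;> rfl
      right_inv := by rintro (_ | _) <;> rfl }
  exact (Nat.card_congr e).trans (by simp)

/-- The map sending `u` to `a`, `v ≠ u` to `b` and all other vertices to `c`. -/
noncomputable def colour {V : Type u} {W : Type v} (u v : V) (a b c : W) (x : V) : W :=
  open Classical in if x = u then a else if x = v then b else c

section colour

variable {V : Type u} {W : Type v} {u v : V} {a b c : W}

theorem colour_left : colour u v a b c u = a := if_pos rfl

theorem colour_right (h : u ≠ v) : colour u v a b c v = b :=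
  (if_neg h.symm).trans (if_pos rfl)

theorem colour_hom {G : Digraph V} {H : Digraph W} (haa : G.Adj u u → H.Adj a a)
    (hab : G.Adj u v → H.Adj a b) (hba : G.Adj v u → H.Adj b a)
    (hbb : G.Adj v v → H.Adj b b) (hac : H.Adj a c) (hca : H.Adj c a) (hbc : H.Adj b c)
    (hcb : H.Adj c b) (hcc : H.Adj c c) (x y : V) (h : G.Adj x y) :
    H.Adj (colour u v a b c x) (colour u v a b c y) := by
  unfold colour
  split_ifs <;> simp_all

end colour

instance : DecidableRel G₁.Adj := fun _ _ => by unfold G₁; infer_instance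
instance : DecidableRel S₁.Adj := fun _ _ => by unfold S₁; infer_instance
instance : DecidableRel R₁.Adj := fun _ _ => by unfold R₁; infer_instance

/-- Every map into the looped complete graph on `a`, `b` is a homomorphism. -/
theorem exists_hom_of_complete {V : Type u} {W : Type v} (G : Digraph V) {H : Digraph W} (a b : W)
    (hab : a ≠ b) (haa : H.Adj a a) (hbb : H.Adj b b) (h : H.Adj a b) (h' : H.Adj b a) (u v : V)
    (huv : u ≠ v) :
    ∃ φ : V → W, (∀ x y, G.Adj x y → H.Adj (φ x) (φ y)) ∧ φ u ≠ φ v :=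
  ⟨colour u v a b b, colour_hom (fun _ => haa) (fun _ => h) (fun _ => h') (fun _ => hbb) h h' hbb
    hbb hbb, by rwa [colour_left, colour_right huv]⟩

/-- A missing loop is a non-edge from `u` to itself: `u` alone goes to the loopless `a`, so the
second colour is never used. -/
theorem exists_hom_of_loopless {V : Type u} {W : Type v} {G : Digraph V} {H : Digraph W} (a b : W)
    (haa : ¬ H.Adj a a) (hbb : H.Adj b b) (h : H.Adj a b) (h' : H.Adj b a) {u : V}
    (hu : ¬ G.Adj u u) :
    ∃ φ : V → W, (∀ x y, G.Adj x y → H.Adj (φ x) (φ y)) ∧ ¬ H.Adj (φ u) (φ u) :=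
  ⟨colour u u a a b, colour_hom (absurd · hu) (absurd · hu) (absurd · hu) (absurd · hu) h h' h h'
    hbb, by rwa [colour_left]⟩

theorem dividesProduct_G₁ {V : Type u} (G : Digraph V) :
    DividesProduct.{0, u} {A G₁} (A G).carrier := by
  refine dividesProduct_A G G₁ ⟨fun _ => 1, fun _ _ _ => of_decide_eq_true rfl⟩ (fun u v huv => ?_)
    (exists_hom_of_complete G 1 3 (by decide) (by decide) (by decide) (by decide) (by decide))
  by_cases h : u = v
  · subst h
    exact exists_hom_of_loopless 0 1 (by decide) (by decide) (by decide) (by decide) huv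
  -- The only non-edge between distinct looped vertices of `G₁` is from 2 to 1; the reverse edge is
  -- present in case `v ∼ u`.
  · refine ⟨colour u v 2 1 3, colour_hom (fun _ => ?_) (absurd · huv) (fun _ => ?_) (fun _ => ?_)
      ?_ ?_ ?_ ?_ ?_, ?_⟩
    case refine_9 => rw [colour_left, colour_right h]; decide
    all_goals decide

theorem dividesProduct_S₁ {V : Type u} (G : Digraph V) (hG : ∀ x y, G.Adj x y → G.Adj y x) :
    DividesProduct.{0, u} {A S₁} (A G).carrier := by
  refine dividesProduct_A G S₁ ⟨fun _ => 1, fun _ _ _ => of_decide_eq_true rfl⟩ (fun u v huv => ?_)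
    (exists_hom_of_complete G 1 2 (by decide) (by decide) (by decide) (by decide) (by decide))
  by_cases h : u = v
  · subst h
    exact exists_hom_of_loopless 0 1 (by decide) (by decide) (by decide) (by decide) huv
  -- By symmetry `v ≁ u` too, so 1 and 3, not joined in either direction, can serve.
  · refine ⟨colour u v 1 3 2, colour_hom (fun _ => ?_) (absurd · huv)
      (fun hvu => absurd (hG _ _ hvu) huv) (fun _ => ?_) ?_ ?_ ?_ ?_ ?_, ?_⟩
    case refine_8 => rw [colour_left, colour_right h]; decide
    all_goals decide

theorem dividesProduct_R₁ {V : Type u} (G : Digraph V) (hG : ∀ x, G.Adj x x) :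
    DividesProduct.{0, u} {A R₁} (A G).carrier := by
  refine dividesProduct_A G R₁ ⟨fun _ => 0, fun _ _ _ => of_decide_eq_true rfl⟩ (fun u v huv => ?_)
    (exists_hom_of_complete G 0 2 (by decide) (by decide) (by decide) (by decide) (by decide))
  -- Reflexivity excludes missing loops, so no loopless vertex is needed in `R₁`.
  have h : u ≠ v := fun h => huv (h ▸ hG u)
  refine ⟨colour u v 1 0 2, colour_hom (fun _ => ?_) (absurd · huv) (fun _ => ?_) (fun _ => ?_)
    ?_ ?_ ?_ ?_ ?_, ?_⟩
  case refine_9 => rw [colour_left, colour_right h]; decide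
  all_goals decide

end AdjSemigroup

theorem proposition5p1 :
    (AdjSemigroup.varA.{u} = AdjSemigroup.HSP.{0, u} {AdjSemigroup.A AdjSemigroup.G₁} ∧
      Nat.card (AdjSemigroup.A AdjSemigroup.G₁).carrier = 17) ∧
    (AdjSemigroup.varAsymm.{u} = AdjSemigroup.HSP.{0, u} {AdjSemigroup.A AdjSemigroup.S₁} ∧
      Nat.card (AdjSemigroup.A AdjSemigroup.S₁).carrier = 17) ∧
    (AdjSemigroup.varAref.{u} = AdjSemigroup.HSP.{0, u} {AdjSemigroup.A AdjSemigroup.R₁} ∧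
      Nat.card (AdjSemigroup.A AdjSemigroup.R₁).carrier = 10) := by
  open AdjSemigroup in
  refine ⟨⟨?_, card_A G₁⟩, ⟨?_, card_A S₁⟩, ⟨?_, card_A R₁⟩⟩
  · simpa only [varA, true_and] using
      HSP_eq_of_dividesProduct G₁ (fun _ => True) trivial fun G _ => dividesProduct_G₁ G
  · refine HSP_eq_of_dividesProduct S₁ (fun G => ∀ x y, G.Adj x y → G.Adj y x) ?_
      dividesProduct_S₁
    have h : ∀ x y, S₁.Adj x y → S₁.Adj y x := by decide
    exact fun x y => h x.down y.down
  · refine HSP_eq_of_dividesProduct R₁ (fun G => ∀ x, G.Adj x x) ?_ dividesProduct_R₁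
    have h : ∀ x, R₁.Adj x x := by decide
    exact fun x => h x.down
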